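/- Let $X$ be a real Banach space and let $M_X$ be the family of all nonempty bounded subsets of $X$. A map $\mu: M_X\to[0,\infty)$ is called a measure of noncompactness if for all $A,B\in M_X$: - (M1) $\mu(C)=0$ for some $C\in M_X$, and every $A\in M_X$ with $\mu(A)=0$ is relatively compact; - (M2) $A\subseteq B$ implies $\mu(A)\le\mu(B)$; - (M3) $\mu(\overline{A})=\mu(A)$; - (M4) $\mu(\operatorname{conv}A)=\mu(A)$, where $\operatorname{conv}A$ is the convex hull of $A$; - (M5) $\mu(\lambda A+(1-\lambda)B)\le\lambda\mu(A)+(1-\lambda)\mu(B)$ for all $\lambda\in[0,1]$; - (M6) if $(A_n)$ is a sequence of closed sets in $M_X$ with $A_{n+1}\subseteq A_n$ for all $n$ and $\lim_{n\to\infty}\mu(A_n)=0$, then $\bigcap_n A_n\neq\emptyset$. **Corollary 3.5.** Let $E$ be a nonempty, bounded, closed and convex subset of $X$, let $T:E\to E$ be continuous, and let $\mu$ be an arbitrary measure of noncompactness on $X$. Let $I_n,\phi_n:[0,\infty)\to\mathbb{R}$ ($n\in\mathbb{N}$) be functions such that $I_n$ converges, uniformly on $[0,\infty)$, to the identity $I(u)=u$,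 and suppose that $$I_n(\mu(TA))\le\phi_n(\mu(A))\qquad\text{for every nonempty } A\subseteq E \text{ and every } n\in\mathbb{N}.$$ Suppose further that - (a) for $u,v\in[0,\infty)$: if $I_n(u)\le\phi_n(v)$ for all $n\in\mathbb{N}$, then $u\le v$; - (b) for sequences $(u_k),(v_k)$ in $[0,\infty)$ with $\lim_{k\to\infty}u_k=\lim_{k\to\infty}v_k=w\in[0,\infty)$: if $I_n(u_k)\le\phi_n(v_k)$ for all $n,k\in\mathbb{N}$, then $w=0$. Then $T$ has a fixed point in $E$. -/

import Mathlib

open Filter Topology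
open scoped NNReal Pointwise

/-- The family `M_X` of all nonempty bounded subsets of `X`. -/
def nonemptyBoundedSets (X : Type*) [NormedAddCommGroup X] : Set (Set X) :=
  {A | A.Nonempty ∧ Bornology.IsBounded A}

/-- An (axiomatic) measure of noncompactness on a real normed space `X`: a map from the family
`M_X` of nonempty bounded subsets of `X` to `[0, ∞)` with the six properties below. The map is
written as a function on all sets, but only its values on `M_X` are constrained or used. -/
structure IsMeasureOfNoncompactness {X : Type*} [NormedAddCommGroup X] [NormedSpace ℝ X]
    (μ : Set X → ℝ≥0) : Prop where
  /-- The kernel is nonempty. -/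
  ker_nonempty : ∃ A ∈ nonemptyBoundedSets X, μ A = 0
  /-- The members of the kernel are relatively compact. -/
  ker_subset : ∀ A ∈ nonemptyBoundedSets X, μ A = 0 → IsCompact (closure A)
  /-- Monotonicity. -/
  mono : ∀ A ∈ nonemptyBoundedSets X, ∀ B ∈ nonemptyBoundedSets X, A ⊆ B → μ A ≤ μ B
  /-- Invariance under closure. -/
  closure_eq : ∀ A ∈ nonemptyBoundedSets X, μ (closure A) = μ A
  /-- Invariance under the convex hull. -/
  convexHull_eq : ∀ A ∈ nonemptyBoundedSets X, μ (convexHull ℝ A) = μ A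
  /-- Convexity with respect to Minkowski combinations. -/
  convex_comb : ∀ A ∈ nonemptyBoundedSets X, ∀ B ∈ nonemptyBoundedSets X,
    ∀ t : ℝ, 0 ≤ t → t ≤ 1 →
      (μ (t • A + (1 - t) • B) : ℝ) ≤ t * (μ A : ℝ) + (1 - t) * (μ B : ℝ)
  /-- Generalized Cantor intersection property. -/
  iInter_nonempty : ∀ A : ℕ → Set X, (∀ n, A n ∈ nonemptyBoundedSets X) →
    (∀ n, IsClosed (A n)) → (∀ n, A (n + 1) ⊆ A n) →
    Tendsto (fun n => μ (A n)) atTop (𝓝 0) → (⋂ n, A n).Nonempty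

/-!
Let `A 0 = E` and let `A (k + 1)` be the closed convex hull of `T '' A k` (`darboSets`). These are
decreasing closed convex sets, and `μ (A (k + 1)) = μ (T '' A k)`. The hypothesis `hT` with `ha`
makes `μ (A k)` nonincreasing, hence convergent, and `hb` applied to the sequence and its shift
shows that the limit is `0`. The intersection of the `A k` is then a nonempty compact convex
set which `T` maps into itself, and Schauder's theorem gives a fixed point
(`IsMeasureOfNoncompactness.exists_fixedPoint`).

Schauder's theorem (`IsCompact.exists_fixedPoint_of_convex`) is reduced to Brouwer's theorem on a
standard simplex by Schauder projections. Brouwer's theorem in turn follows, by smooth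
approximation, from the absence of `C¹` retractions of the ball onto the sphere
(`not_exists_contDiffOn_retraction_sphere`), which is proved by the argument of Milnor and Rogers:
the integral over the ball of the Jacobian determinant of `x ↦ x + t • (r x - x)` would be a
polynomial in `t`, equal to the volume of the ball for small `t ≥ 0`, and zero for `t = 1`.
-/

/-! ### Determinants of `1 + s • A` -/

/-- The determinant of `1 + s • A` is a polynomial of degree at most `dim V` in `s`, so it is
recovered by Lagrange interpolation from its values at `dim V + 1` nodes. The weights do not
depend on `A`, which allows integrating the formula over a family of maps `A`. -/
theorem ContinuousLinearMap.det_one_add_smul_eq_sum_lagrange {V : Type*} [NormedAddCommGroup V]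
    [NormedSpace ℝ V] [FiniteDimensional ℝ V] {t : ℕ → ℝ} (ht : Function.Injective t)
    (A : V →L[ℝ] V) (s : ℝ) :
    (1 + s • A).det = ∑ j ∈ Finset.range (Module.finrank ℝ V + 1),
      (1 + t j • A).det *
        (Lagrange.basis (Finset.range (Module.finrank ℝ V + 1)) t j).eval s := by
  classical
  let b := Module.finBasis ℝ V
  let M := LinearMap.toMatrix b b (A : V →ₗ[ℝ] V)
  let P : Polynomial ℝ :=
    Matrix.det ((Polynomial.X : Polynomial ℝ) • M.map Polynomial.C +
      (1 : Matrix _ _ ℝ).map Polynomial.C)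
  have hP (u : ℝ) : (1 + u • A).det = P.eval u := by
    rw [ContinuousLinearMap.det, ← LinearMap.det_toMatrix b, ← Polynomial.coe_evalRingHom,
      RingHom.map_det]
    congr 1
    ext i j
    simp [M, Matrix.one_apply, LinearMap.toMatrix_apply, Finsupp.single_apply, eq_comm]
    split_ifs <;> simp [mul_comm, add_comm]
  have hdeg : P.degree < (Finset.range (Module.finrank ℝ V + 1)).card := by
    refine lt_of_le_of_lt Polynomial.degree_le_natDegree ?_
    have := Polynomial.natDegree_det_X_add_C_le M 1
    simp only [Fintype.card_fin, Finset.card_range] at this ⊢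
    exact_mod_cast Nat.lt_succ_of_le this
  rw [hP, Lagrange.eq_interpolate (v := t) ht.injOn hdeg, Lagrange.interpolate_apply,
    Polynomial.eval_finsetSum]
  simp [hP]

/-- For `s * ‖A‖ < 1` the maps `1 + u • A`, `0 ≤ u ≤ s`, are injective, so their determinant keeps
the sign it has at `u = 0`. -/
theorem ContinuousLinearMap.det_one_add_smul_pos {V : Type*} [NormedAddCommGroup V]
    [NormedSpace ℝ V] [FiniteDimensional ℝ V] {A : V →L[ℝ] V} {s : ℝ} (hs : 0 ≤ s)
    (hA : s * ‖A‖ < 1) : 0 < (1 + s • A).det := by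
  by_contra! hneg
  have hcont : Continuous fun u : ℝ => (1 + u • A).det :=
    ContinuousLinearMap.continuous_det.comp (by fun_prop)
  obtain ⟨u, hu, hdet⟩ : (0 : ℝ) ∈ (fun u : ℝ => (1 + u • A).det) '' Set.Icc 0 s :=
    intermediate_value_Icc' hs hcont.continuousOn ⟨hneg, by simp [ContinuousLinearMap.det]⟩
  obtain ⟨x, hx, hx0⟩ := (Submodule.ne_bot_iff _).1 (LinearMap.bot_lt_ker_of_det_eq_zero hdet).ne'
  have h1 : x = -(u • A x) := eq_neg_of_add_eq_zero_left (by simpa using hx)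
  have h2 : ‖x‖ ≤ u * (‖A‖ * ‖x‖) := by
    conv_lhs => rw [h1, norm_neg, norm_smul, Real.norm_of_nonneg hu.1]
    gcongr
    exacts [hu.1, A.le_opNorm x]
  have h3 : u * ‖A‖ ≤ s * ‖A‖ := by gcongr; exact hu.2
  nlinarith [norm_pos_iff.2 hx0]

/-! ### The radial retraction onto the unit ball -/

/-- The radial retraction of a normed space onto its closed unit ball. In a general normed space
it is `2`-Lipschitz, and the constant does not matter here. -/
noncomputable def unitBallRetraction {V : Type*} [NormedAddCommGroup V] [NormedSpace ℝ V] (x : V) :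
    V :=
  (max 1 ‖x‖)⁻¹ • x

section unitBallRetraction

variable {V : Type*} [NormedAddCommGroup V] [NormedSpace ℝ V]

theorem norm_unitBallRetraction_le (x : V) : ‖unitBallRetraction x‖ ≤ 1 := by
  have h : 0 < max 1 ‖x‖ := by positivity
  rw [unitBallRetraction, norm_smul, norm_inv, Real.norm_of_nonneg h.le, inv_mul_le_one₀ h]
  exact le_max_right _ _

theorem unitBallRetraction_of_norm_le {x : V} (hx : ‖x‖ ≤ 1) : unitBallRetraction x = x := by
  simp [unitBallRetraction, max_eq_left hx]

theorem norm_unitBallRetraction_of_one_le {x : V} (hx : 1 ≤ ‖x‖) : ‖unitBallRetraction x‖ = 1 := by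
  rw [unitBallRetraction, max_eq_right hx, norm_smul, norm_inv, norm_norm]
  exact inv_mul_cancel₀ (by positivity)

theorem norm_unitBallRetraction_sub_le (x y : V) :
    ‖unitBallRetraction x - unitBallRetraction y‖ ≤ 2 * ‖x - y‖ := by
  set m := max 1 ‖x‖ with hm
  set k := max 1 ‖y‖ with hk
  have hm1 : 1 ≤ m := le_max_left _ _
  have hk1 : 1 ≤ k := le_max_left _ _
  have hyk : ‖y‖ ≤ k := le_max_right _ _
  have hm0 : 0 < m := by positivity
  have hk0 : 0 < k := by positivity
  have hkm : |k - m| ≤ ‖x - y‖ := by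
    refine (abs_max_sub_max_le_max 1 ‖y‖ 1 ‖x‖).trans ?_
    rw [sub_self, abs_zero, max_eq_right (abs_nonneg _), norm_sub_rev]
    exact abs_norm_sub_norm_le y x
  have hsplit : unitBallRetraction x - unitBallRetraction y
      = m⁻¹ • (x - y) + (m⁻¹ - k⁻¹) • y := by
    simp only [unitBallRetraction, ← hm, ← hk]
    module
  have h1 : ‖m⁻¹ • (x - y)‖ ≤ ‖x - y‖ := by
    rw [norm_smul, norm_inv, Real.norm_of_nonneg hm0.le]
    exact mul_le_of_le_one_left (norm_nonneg _) (inv_le_one_of_one_le₀ hm1)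
  have h2 : ‖(m⁻¹ - k⁻¹) • y‖ ≤ ‖x - y‖ := by
    have : m⁻¹ - k⁻¹ = (k - m) * m⁻¹ * k⁻¹ := by field_simp
    rw [norm_smul, this, norm_mul, norm_mul, norm_inv, norm_inv, Real.norm_of_nonneg hm0.le,
      Real.norm_of_nonneg hk0.le, Real.norm_eq_abs, mul_assoc, mul_assoc]
    have h3 : m⁻¹ * (k⁻¹ * ‖y‖) ≤ 1 :=
      mul_le_one₀ (inv_le_one_of_one_le₀ hm1) (by positivity) ((inv_mul_le_one₀ hk0).2 hyk)
    exact (mul_le_of_le_one_right (abs_nonneg _) h3).trans hkm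
  rw [hsplit]
  linarith [norm_add_le (m⁻¹ • (x - y)) ((m⁻¹ - k⁻¹) • y)]

theorem continuous_unitBallRetraction : Continuous (unitBallRetraction : V → V) :=
  (LipschitzWith.of_dist_le_mul (K := 2) fun x y => by
    simpa [dist_eq_norm] using norm_unitBallRetraction_sub_le x y).continuous

end unitBallRetraction

/-! ### The smooth no-retraction theorem -/

/-- A small Lipschitz perturbation of the identity that fixes the unit sphere maps the unit ball
onto itself: a preimage of `y` is a fixed point of the contraction
`x ↦ y - t • h (unitBallRetraction x)`. -/
theorem image_add_smul_closedBall_eq {V : Type*} [NormedAddCommGroup V] [NormedSpace ℝ V]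
    [CompleteSpace V] {h : V → V} {C t : ℝ} (hC : 0 ≤ C) (ht : 0 ≤ t) (ht1 : t * (2 * C + 1) < 1)
    (hh : ∀ x ∈ Metric.closedBall (0 : V) 1, ∀ y ∈ Metric.closedBall (0 : V) 1,
      ‖h x - h y‖ ≤ C * ‖x - y‖)
    (hball : ∀ x ∈ Metric.closedBall (0 : V) 1, x + h x ∈ Metric.closedBall (0 : V) 1)
    (hsphere : ∀ x : V, ‖x‖ = 1 → h x = 0) :
    (fun x => x + t • h x) '' Metric.closedBall 0 1 = Metric.closedBall 0 1 := by
  have htC : 0 ≤ t * C := mul_nonneg ht hC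
  apply Set.Subset.antisymm
  · rintro _ ⟨x, hx, rfl⟩
    have htle : t ≤ 1 := by nlinarith
    have := convex_closedBall (0 : V) 1 hx (hball x hx) (sub_nonneg.2 htle) ht
      (sub_add_cancel 1 t)
    convert this using 1
    module
  · intro y hy
    have hP (x : V) : unitBallRetraction x ∈ Metric.closedBall (0 : V) 1 := by
      simpa using norm_unitBallRetraction_le x
    have hcontr : ContractingWith (t * (2 * C)).toNNReal
        (fun x => y - t • h (unitBallRetraction x)) := by
      refine ⟨?_, LipschitzWith.of_dist_le_mul fun x z => ?_⟩
      · rw [Real.toNNReal_lt_one]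
        linarith
      · rw [Real.coe_toNNReal _ (by positivity)]
        simp only [dist_eq_norm, sub_sub_sub_cancel_left, ← smul_sub, norm_smul,
          Real.norm_of_nonneg ht]
        calc t * ‖h (unitBallRetraction z) - h (unitBallRetraction x)‖
            ≤ t * (C * (2 * ‖z - x‖)) := by
              gcongr
              exact (hh _ (hP z) _ (hP x)).trans (by
                gcongr; exact norm_unitBallRetraction_sub_le z x)
          _ = t * (2 * C) * ‖x - z‖ := by rw [norm_sub_rev]; ring
    have hfix := hcontr.fixedPoint_isFixedPt
    set x := ContractingWith.fixedPoint _ hcontr with hx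
    replace hfix : y - t • h (unitBallRetraction x) = x := hfix
    -- Outside the ball the perturbation vanishes, so a fixed point there would equal `y`.
    have hxB : ‖x‖ ≤ 1 := by
      by_contra! hlt
      rw [hsphere _ (norm_unitBallRetraction_of_one_le hlt.le), smul_zero, sub_zero] at hfix
      rw [← hfix] at hlt
      exact hlt.not_ge (by simpa using hy)
    rw [unitBallRetraction_of_norm_le hxB] at hfix
    exact ⟨x, by simpa using hxB, eq_add_of_sub_eq hfix ▸ rfl⟩

open MeasureTheory in
/-- There is no `C¹` retraction of the closed unit ball onto the sphere (Milnor–Rogers argument).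
With `h x = r x - x`, the integral of `det (1 + t • h')` over the ball is a polynomial in `t`. For
small `t ≥ 0` it is the volume of the image of the ball under `x ↦ x + t • h x`, that is, of the
ball itself; hence it also equals that volume at `t = 1`. But there it is the integral of `det r'`,
which vanishes because `r` takes values in the sphere. -/
theorem not_exists_contDiffOn_retraction_sphere {V : Type*} [NormedAddCommGroup V]
    [InnerProductSpace ℝ V] [FiniteDimensional ℝ V] {r : V → V} {U : Set V} (hU : IsOpen U)
    (hBU : Metric.closedBall 0 1 ⊆ U) (hr : ContDiffOn ℝ 1 r U) (hr1 : ∀ x ∈ U, ‖r x‖ = 1)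
    (hr_sphere : ∀ x, ‖x‖ = 1 → r x = x) : False := by
  let _ : MeasurableSpace V := borel V
  have : BorelSpace V := ⟨rfl⟩
  let ν : Measure V := Measure.addHaar
  set B : Set V := Metric.closedBall 0 1 with hB
  have hBc : IsCompact B := isCompact_closedBall 0 1
  let h : V → V := fun x => r x - x
  have hdr (x) (hx : x ∈ U) : DifferentiableAt ℝ r x :=
    (hr.differentiableOn one_ne_zero).differentiableAt (hU.mem_nhds hx)
  have hhC : ContDiffOn ℝ 1 h U := hr.sub contDiffOn_id
  have hdh (x) (hx : x ∈ U) : DifferentiableAt ℝ h x :=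
    (hhC.differentiableOn one_ne_zero).differentiableAt (hU.mem_nhds hx)
  have hcont : ContinuousOn (fderiv ℝ h) B :=
    (hhC.continuousOn_fderiv_of_isOpen hU le_rfl).mono hBU
  obtain ⟨C, hC⟩ := hBc.exists_bound_of_continuousOn hcont
  have hC0 : 0 ≤ C := (norm_nonneg _).trans (hC 0 (by simp [hB]))
  have hLip : ∀ x ∈ B, ∀ y ∈ B, ‖h x - h y‖ ≤ C * ‖x - y‖ := fun x hx y hy =>
    (convex_closedBall (0 : V) 1).norm_image_sub_le_of_norm_fderiv_le
      (fun z hz => hdh z (hBU hz)) hC hy hx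
  have hvol (t : ℝ) (ht : 0 ≤ t) (ht1 : t * (2 * C + 1) < 1) :
      ∫ x in B, (1 + t • fderiv ℝ h x).det ∂ν = ν.real B := by
    have htC : 0 ≤ t * C := mul_nonneg ht hC0
    have himg := image_add_smul_closedBall_eq hC0 ht ht1 hLip
      (fun x hx => by simp [h, hr1 x (hBU hx)]) (fun x hx => by simp [h, hr_sphere x hx])
    have hinj : Set.InjOn (fun x => x + t • h x) B := by
      intro x hx y hy hxy
      have h1 : x - y = t • (h y - h x) := by
        rw [smul_sub, sub_eq_sub_iff_add_eq_add]
        simpa [add_comm] using hxy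
      have h2 : ‖x - y‖ ≤ t * (C * ‖x - y‖) := by
        conv_lhs => rw [h1, norm_smul, Real.norm_of_nonneg ht]
        gcongr
        rw [norm_sub_rev x y]
        exact hLip y hy x hx
      rw [← sub_eq_zero, ← norm_le_zero_iff]
      nlinarith [norm_nonneg (x - y)]
    have hderiv : ∀ x ∈ B, HasFDerivWithinAt (fun x => x + t • h x) (1 + t • fderiv ℝ h x) B x :=
      fun x hx => ((hasFDerivAt_id x).add
        ((hdh x (hBU hx)).hasFDerivAt.const_smul t)).hasFDerivWithinAt
    have key := integral_image_eq_integral_abs_det_fderiv_smul ν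
      hBc.measurableSet hderiv hinj (fun _ => (1 : ℝ))
    rw [himg] at key
    simp only [smul_eq_mul, mul_one, integral_const, measureReal_restrict_apply_univ] at key
    rw [hB, key]
    refine setIntegral_congr_fun hBc.measurableSet fun x hx => (abs_of_pos ?_).symm
    refine ContinuousLinearMap.det_one_add_smul_pos ht ?_
    nlinarith [mul_le_mul_of_nonneg_left (hC x hx) ht]
  -- The derivative of `r` at `x` only takes values orthogonal to `r x ≠ 0`.
  have hdet0 (x) (hx : x ∈ B) : (1 + (1 : ℝ) • fderiv ℝ h x).det = 0 := by
    have hfd : (1 + (1 : ℝ) • fderiv ℝ h x) = fderiv ℝ r x := by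
      have : fderiv ℝ h x = fderiv ℝ r x - ContinuousLinearMap.id ℝ V := by
        have := fderiv_fun_sub (hdr x (hBU hx)) (differentiableAt_id (𝕜 := ℝ) (x := x))
        simpa [h] using this
      rw [this, one_smul]; exact add_sub_cancel _ _
    rw [hfd]
    by_contra hne
    have hsurj : Function.Surjective (fderiv ℝ r x) := by
      exact (LinearMap.equivOfDetNeZero _ hne).surjective
    obtain ⟨v, hv⟩ := hsurj (r x)
    have hconst : (fun y => inner ℝ (r y) (r y)) =ᶠ[𝓝 x] fun _ => (1 : ℝ) := by
      filter_upwards [hU.mem_nhds (hBU hx)] with y hy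
      rw [real_inner_self_eq_norm_sq, hr1 y hy, one_pow]
    have h0 := hconst.fderiv_eq (𝕜 := ℝ)
    have h1 := congrArg (fun L : V →L[ℝ] ℝ => L v) h0
    rw [fderiv_inner_apply ℝ (hdr x (hBU hx)) (hdr x (hBU hx)), hv] at h1
    have := hr1 x (hBU hx)
    simp [this] at h1
  -- The interpolation nodes are distinct parameters in the range where `hvol` applies.
  let τ : ℕ → ℝ := fun j => ((2 * C + 1) * (j + 2))⁻¹
  have hτ : Function.Injective τ := by
    intro i j hij
    have h1 : (2 * C + 1) * ((i : ℝ) + 2) = (2 * C + 1) * (j + 2) := inv_injective hij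
    have h2 := mul_left_cancel₀ (by positivity) h1
    exact_mod_cast add_right_cancel h2
  have hτ0 (j) : 0 ≤ τ j := by positivity
  have hτ1 (j) : τ j * (2 * C + 1) < 1 := by
    have : τ j * (2 * C + 1) = ((j : ℝ) + 2)⁻¹ := by simp only [τ]; field_simp
    rw [this]
    exact inv_lt_one_of_one_lt₀ (by linarith [(Nat.cast_nonneg j : (0 : ℝ) ≤ j)])
  have hint (j : ℕ) : IntegrableOn (fun x => (1 + τ j • fderiv ℝ h x).det) B ν :=
    ContinuousOn.integrableOn_compact hBc
      ((ContinuousLinearMap.continuous_det.comp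
        (f := fun L : V →L[ℝ] V => 1 + τ j • L) (by fun_prop)).comp_continuousOn hcont)
  have hzero : ∫ x in B, (1 + (1 : ℝ) • fderiv ℝ h x).det ∂ν = 0 :=
    setIntegral_eq_zero_of_forall_eq_zero hdet0
  set s := Finset.range (Module.finrank ℝ V + 1)
  have hsum : ∑ j ∈ s, (Lagrange.basis s τ j).eval 1 = 1 := by
    rw [← Polynomial.eval_finsetSum, Lagrange.sum_basis hτ.injOn ⟨0, by simp [s]⟩,
      Polynomial.eval_one]
  have hBvol : ν.real B = 0 := by
    simp_rw [ContinuousLinearMap.det_one_add_smul_eq_sum_lagrange hτ _ (1 : ℝ)] at hzero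
    rw [integral_finsetSum _ fun j _ => (hint j).mul_const _] at hzero
    simp_rw [integral_mul_const, hvol _ (hτ0 _) (hτ1 _)] at hzero
    rwa [← Finset.mul_sum, hsum, mul_one] at hzero
  exact (ENNReal.toReal_pos (Metric.measure_closedBall_pos ν 0 one_pos).ne'
    hBc.measure_lt_top.ne).ne' hBvol

/-! ### Brouwer's fixed point theorem -/

/-- Brouwer's theorem for a `C¹` map of the unit ball: without fixed points, sending `x` to the
point where the ray from `g x` through `x` leaves the ball would be a `C¹` retraction onto the
sphere. -/
theorem exists_fixedPoint_closedBall_of_contDiff {V : Type*} [NormedAddCommGroup V]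
    [InnerProductSpace ℝ V] [FiniteDimensional ℝ V] {g : V → V} (hg : ContDiff ℝ 1 g)
    (hmaps : ∀ x, ‖x‖ ≤ 1 → ‖g x‖ ≤ 1) : ∃ x, ‖x‖ ≤ 1 ∧ g x = x := by
  by_contra! hfix
  let d : V → V := fun x => x - g x
  let a : V → ℝ := fun x => inner ℝ (d x) (d x)
  let b : V → ℝ := fun x => inner ℝ x (d x)
  let c : V → ℝ := fun x => 1 - inner ℝ x x
  let D : V → ℝ := fun x => b x ^ 2 + a x * c x
  have hd : ContDiff ℝ 1 d := contDiff_id.sub hg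
  have ha : ContDiff ℝ 1 a := hd.inner ℝ hd
  have hb : ContDiff ℝ 1 b := contDiff_id.inner ℝ hd
  have hc : ContDiff ℝ 1 c := contDiff_const.sub (contDiff_id.inner ℝ contDiff_id)
  have hD : ContDiff ℝ 1 D := (hb.pow 2).add (ha.mul hc)
  -- `r x = x + l • d x`, where `l` is the larger root of `a l ^ 2 + 2 b l - c = 0`,
  -- which is the equation `‖x + l • d x‖ = 1`.
  let r : V → V := fun x => x + ((-b x + √(D x)) / a x) • d x
  have hb_pos (x) (hx : ‖x‖ = 1) : 0 < b x := by
    have hne : x ≠ g x := (hfix x hx.le).symm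
    have h1 : b x = 1 - inner ℝ x (g x) := by
      simp only [b, d, inner_sub_right, real_inner_self_eq_norm_sq, hx, one_pow]
    have h2 : 0 < ‖x - g x‖ ^ 2 := by
      have := norm_pos_iff.2 (sub_ne_zero.2 hne)
      positivity
    rw [norm_sub_sq_real, hx] at h2
    nlinarith [hmaps x hx.le, norm_nonneg (g x)]
  refine not_exists_contDiffOn_retraction_sphere (r := r) (U := {x | 0 < D x ∧ 0 < a x})
    ((isOpen_lt continuous_const hD.continuous).inter
      (isOpen_lt continuous_const ha.continuous)) ?_ ?_ ?_ ?_
  · intro x hx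
    have hx1 : ‖x‖ ≤ 1 := by simpa using hx
    have ha0 : 0 < a x := real_inner_self_pos.2 (sub_ne_zero.2 (hfix x hx1).symm)
    refine ⟨?_, ha0⟩
    rcases hx1.lt_or_eq with hlt | heq
    · have : 0 < c x := by
        simp only [c, real_inner_self_eq_norm_sq]
        nlinarith [norm_nonneg x]
      positivity
    · have h1 := hb_pos x heq
      have h2 : c x = 0 := by simp [c, heq]
      simp only [D, h2, mul_zero, add_zero]
      positivity
  · exact contDiffOn_id.add (((hb.neg.contDiffOn.add
      (hD.contDiffOn.sqrt fun x hx => hx.1.ne')).div ha.contDiffOn fun x hx => hx.2.ne').smul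
      hd.contDiffOn)
  · rintro x ⟨hDx, hax⟩
    set l := (-b x + √(D x)) / a x with hl
    have hal : a x * l = -b x + √(D x) := by rw [hl]; field_simp
    have hs := Real.sq_sqrt hDx.le
    have hexp : ‖r x‖ ^ 2 = 1 - c x + 2 * l * b x + l ^ 2 * a x := by
      simp only [r, ← hl]
      rw [norm_add_sq_real, norm_smul, mul_pow, inner_smul_right]
      simp only [a, b, c, real_inner_self_eq_norm_sq, Real.norm_eq_abs, sq_abs]
      ring
    have hzero : a x * (2 * l * b x + l ^ 2 * a x - c x) = 0 := by
      have : a x * (2 * l * b x + l ^ 2 * a x - c x)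
          = (a x * l) ^ 2 + 2 * b x * (a x * l) - a x * c x := by ring
      rw [this, hal]
      have hDdef : D x = b x ^ 2 + a x * c x := rfl
      linear_combination hs + hDdef
    have h1 : ‖r x‖ ^ 2 = 1 := by
      rw [hexp]
      linear_combination (mul_eq_zero.1 hzero).resolve_left hax.ne'
    exact (pow_eq_one_iff_of_nonneg (norm_nonneg _) two_ne_zero).1 h1
  · intro x hx
    have h2 : c x = 0 := by simp [c, hx]
    have h3 : √(D x) = b x := by
      simp only [D, h2, mul_zero, add_zero]
      exact Real.sqrt_sq (hb_pos x hx).le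
    simp [r, h3]

/-- Brouwer's theorem for continuous self-maps of the whole space with values in the unit ball,
deduced from the smooth case by approximation. -/
theorem Continuous.exists_fixedPoint_of_norm_le_one {V : Type*} [NormedAddCommGroup V]
    [InnerProductSpace ℝ V] [FiniteDimensional ℝ V] {f : V → V} (hf : Continuous f)
    (hf1 : ∀ x, ‖f x‖ ≤ 1) : ∃ x, f x = x := by
  by_contra! hfix
  obtain ⟨x₀, -, hx₀⟩ := (isCompact_closedBall (0 : V) 1).exists_isMinOn
    ⟨0, by simp⟩ (f := fun x => ‖f x - x‖) (by fun_prop)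
  have hη : 0 < ‖f x₀ - x₀‖ / 2 := half_pos (norm_pos_iff.2 (sub_ne_zero.2 (hfix x₀)))
  set η := ‖f x₀ - x₀‖ / 2 with hη_def
  obtain ⟨g, hg, hgf, -⟩ := hf.exists_contDiff_approx 1 (ε := fun _ => η) continuous_const
    fun _ => hη
  simp only [dist_eq_norm] at hgf
  have hg1 (x) : ‖g x‖ ≤ 1 + η := by
    linarith [hgf x, hf1 x, norm_le_norm_add_norm_sub' (g x) (f x)]
  -- The approximation `g` may leave the ball by `η`, hence the rescaling.
  obtain ⟨x, hx1, hx⟩ := exists_fixedPoint_closedBall_of_contDiff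
      (hg.const_smul (1 + η)⁻¹) fun x _ => by
    rw [norm_smul, norm_inv, Real.norm_of_nonneg (by positivity),
      inv_mul_le_one₀ (by positivity)]
    exact hg1 x
  have hgx : g x = x + η • x := by
    have : (1 + η) • ((1 + η)⁻¹ • g x) = (1 + η) • x := congrArg _ hx
    rwa [smul_inv_smul₀ (by positivity), add_smul, one_smul] at this
  have h1 : ‖g x - x‖ ≤ η := by
    rw [hgx, add_sub_cancel_left, norm_smul, Real.norm_of_nonneg hη.le]
    exact mul_le_of_le_one_right hη.le hx1
  have h2 : ‖f x₀ - x₀‖ ≤ ‖f x - x‖ := hx₀ (by simpa using hx1)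
  have h3 : ‖f x - x‖ ≤ ‖f x - g x‖ + ‖g x - x‖ := norm_sub_le_norm_sub_add_norm_sub _ _ _
  rw [norm_sub_rev (f x) (g x)] at h3
  linarith [hgf x]

/-- A continuous retraction of `ι → ℝ` onto the standard simplex: take positive parts, distribute
the missing mass equally if their sum is below `1`, and divide by the sum if it exceeds `1`. -/
noncomputable def stdSimplexRetraction {ι : Type*} [Fintype ι] (w : ι → ℝ) : ι → ℝ := fun i =>
  (max (w i) 0 + max 0 (1 - ∑ j, max (w j) 0) / Fintype.card ι) / max 1 (∑ j, max (w j) 0)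

theorem stdSimplexRetraction_mem {ι : Type*} [Fintype ι] [Nonempty ι] (w : ι → ℝ) :
    stdSimplexRetraction w ∈ stdSimplex ℝ ι := by
  refine ⟨fun i => by unfold stdSimplexRetraction; positivity, ?_⟩
  simp only [stdSimplexRetraction]
  rw [← Finset.sum_div, Finset.sum_add_distrib, Finset.sum_const, Finset.card_univ, nsmul_eq_mul,
    mul_div_cancel₀ _ (by positivity), div_eq_one_iff_eq (by positivity)]
  rcases le_total 1 (∑ j, max (w j) 0) with h | h
  · rw [max_eq_left (by linarith), max_eq_right h, add_zero]
  · rw [max_eq_right (by linarith), max_eq_left h]; ring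

theorem stdSimplexRetraction_of_mem {ι : Type*} [Fintype ι] {w : ι → ℝ}
    (hw : w ∈ stdSimplex ℝ ι) : stdSimplexRetraction w = w := by
  have h (i) : max (w i) 0 = w i := max_eq_left (hw.1 i)
  ext i
  simp [stdSimplexRetraction, h, hw.2]

theorem continuous_stdSimplexRetraction {ι : Type*} [Fintype ι] :
    Continuous (stdSimplexRetraction : (ι → ℝ) → ι → ℝ) := by
  unfold stdSimplexRetraction
  refine continuous_pi fun i => Continuous.div (by fun_prop) (by fun_prop) fun w => ?_
  positivity

theorem exists_fixedPoint_stdSimplex {ι : Type*} [Fintype ι] [Nonempty ι]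
    {F : (ι → ℝ) → ι → ℝ} (hF : ContinuousOn F (stdSimplex ℝ ι))
    (hmaps : Set.MapsTo F (stdSimplex ℝ ι) (stdSimplex ℝ ι)) :
    ∃ w ∈ stdSimplex ℝ ι, F w = w := by
  let G : EuclideanSpace ℝ ι → EuclideanSpace ℝ ι := fun w =>
    WithLp.toLp 2 (F (stdSimplexRetraction w.ofLp))
  have hmem (w : EuclideanSpace ℝ ι) : F (stdSimplexRetraction w.ofLp) ∈ stdSimplex ℝ ι :=
    hmaps (stdSimplexRetraction_mem _)
  have hG : Continuous G :=
    (PiLp.continuous_toLp 2 _).comp (hF.comp_continuous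
      (continuous_stdSimplexRetraction.comp (PiLp.continuous_ofLp 2 _))
      fun w => stdSimplexRetraction_mem _)
  have hG1 (w) : ‖G w‖ ≤ 1 := by
    rw [← sq_le_one_iff₀ (norm_nonneg _), EuclideanSpace.real_norm_sq_eq, ← (hmem w).2]
    refine Finset.sum_le_sum fun i _ => ?_
    have h := mem_Icc_of_mem_stdSimplex (hmem w) i
    exact pow_le_of_le_one h.1 h.2 two_ne_zero
  obtain ⟨w, hw⟩ := hG.exists_fixedPoint_of_norm_le_one hG1
  have hw' : F (stdSimplexRetraction w.ofLp) = w.ofLp := congrArg WithLp.ofLp hw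
  have hws : w.ofLp ∈ stdSimplex ℝ ι := hw' ▸ hmem w
  exact ⟨w.ofLp, hws, by rwa [stdSimplexRetraction_of_mem hws] at hw'⟩

/-! ### Schauder's fixed point theorem -/

/-- The Schauder projection: up to `ε`, the points of a compact set are convex combinations of
finitely many of its points, with weights depending continuously on the point. -/
theorem IsCompact.exists_schauder_projection {X : Type*} [NormedAddCommGroup X] [NormedSpace ℝ X]
    {K : Set X} (hK : IsCompact K) {ε : ℝ} (hε : 0 < ε) :
    ∃ s : Finset X, (s : Set X) ⊆ K ∧ ∃ p : X → s → ℝ, ContinuousOn p K ∧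
      ∀ z ∈ K, p z ∈ stdSimplex ℝ s ∧ ‖∑ i, p z i • (i : X) - z‖ ≤ ε := by
  obtain ⟨t, htK, htfin, hcover⟩ := hK.finite_cover_balls hε
  lift t to Finset X using htfin
  -- Only the points of `t` within distance `ε` of `z` receive a positive weight.
  let m : X → t → ℝ := fun z i => max 0 (ε - ‖(i : X) - z‖)
  have hm (z i) : 0 ≤ m z i := le_max_left _ _
  have hmc (i) : Continuous fun z => m z i := by fun_prop
  have hS (z) (hz : z ∈ K) : 0 < ∑ i, m z i := by
    obtain ⟨x, hx, hzx⟩ := Set.mem_iUnion₂.1 (hcover hz)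
    refine Finset.sum_pos' (fun i _ => hm z i) ⟨⟨x, hx⟩, Finset.mem_univ _, ?_⟩
    rw [mem_ball_iff_norm'] at hzx
    exact lt_max_of_lt_right (sub_pos.2 hzx)
  refine ⟨t, htK, fun z i => m z i / ∑ j, m z j, ?_, fun z hz => ?_⟩
  · exact continuousOn_pi.2 fun i => (hmc i).continuousOn.div
      (continuous_finsetSum _ fun j _ => hmc j).continuousOn fun z hz => (hS z hz).ne'
  · have hsum : ∑ i, m z i / ∑ j, m z j = 1 := by
      rw [← Finset.sum_div, div_self (hS z hz).ne']
    have hnn (i) : 0 ≤ m z i / ∑ j, m z j := div_nonneg (hm z i) (hS z hz).le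
    refine ⟨⟨hnn, hsum⟩, ?_⟩
    have hz_eq : ∑ i, (m z i / ∑ j, m z j) • (i : X) - z
        = ∑ i, (m z i / ∑ j, m z j) • ((i : X) - z) := by
      simp_rw [smul_sub]
      rw [Finset.sum_sub_distrib, ← Finset.sum_smul, hsum, one_smul]
    calc ‖∑ i, (m z i / ∑ j, m z j) • (i : X) - z‖
        ≤ ∑ i, (m z i / ∑ j, m z j) * ε := by
          rw [hz_eq]
          refine norm_sum_le_of_le _ fun i _ => ?_
          rw [norm_smul, Real.norm_of_nonneg (hnn i)]
          rcases le_or_gt ‖(i : X) - z‖ ε with h | h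
          · exact mul_le_mul_of_nonneg_left h (hnn i)
          · have : m z i = 0 := max_eq_left (by linarith)
            simp [this]
      _ = ε := by rw [← Finset.sum_mul, hsum, one_mul]

/-- **Schauder's fixed point theorem**. Brouwer's theorem, applied to the weights of a Schauder
projection, gives points moved by at most `ε`, and the displacement attains its minimum. -/
theorem IsCompact.exists_fixedPoint_of_convex {X : Type*} [NormedAddCommGroup X] [NormedSpace ℝ X]
    {K : Set X} (hK : IsCompact K) (hconv : Convex ℝ K) (hne : K.Nonempty) {T : X → X}
    (hT : ContinuousOn T K) (hmaps : Set.MapsTo T K K) : ∃ x ∈ K, T x = x := by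
  obtain ⟨x₀, hx₀K, hx₀⟩ := hK.exists_isMinOn hne (f := fun x => ‖x - T x‖)
    (continuousOn_id.sub hT).norm
  refine ⟨x₀, hx₀K, (sub_eq_zero.1 <| norm_le_zero_iff.1 <| le_of_forall_pos_le_add
    fun ε hε => ?_).symm⟩
  rw [zero_add]
  obtain ⟨s, hsK, p, hp, hps⟩ := hK.exists_schauder_projection hε
  let σ : (s → ℝ) → X := fun w => ∑ i, w i • (i : X)
  have hσ : Continuous σ := by fun_prop
  have hσK : Set.MapsTo σ (stdSimplex ℝ s) K := fun w hw =>
    hconv.sum_mem (fun i _ => hw.1 i) hw.2 fun i _ => hsK i.2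
  have : Nonempty s := by
    by_contra hempty
    rw [not_nonempty_iff] at hempty
    simpa using (hps x₀ hx₀K).1.2
  obtain ⟨w, hw, hfix⟩ := exists_fixedPoint_stdSimplex (F := fun w => p (T (σ w)))
    (hp.comp (hT.comp hσ.continuousOn hσK) (hmaps.comp hσK))
    fun w hw => (hps _ (hmaps (hσK hw))).1
  have h1 := (hps _ (hmaps (hσK hw))).2
  have h2 : ∑ i, p (T (σ w)) i • (i : X) = σ w := congrArg σ hfix
  rw [h2] at h1
  exact (hx₀ (hσK hw)).trans h1

/-! ### Measures of noncompactness -/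

/-- The sequence of sets in Darbo's argument: `E`, then repeatedly the closed convex hull of the
image under `T`. -/
def darboSets {X : Type*} [NormedAddCommGroup X] [NormedSpace ℝ X] (T : X → X) (E : Set X) :
    ℕ → Set X
  | 0 => E
  | k + 1 => closure (convexHull ℝ (T '' darboSets T E k))

/-- If the measure of noncompactness tends to `0` along a decreasing sequence of closed convex
sets, each mapped by `T` into the next, then the intersection is nonempty, compact, convex and
`T`-invariant, and Schauder's theorem applies to it. -/
theorem IsMeasureOfNoncompactness.exists_fixedPoint {X : Type*} [NormedAddCommGroup X]
    [NormedSpace ℝ X] {μ : Set X → ℝ≥0} (hμ : IsMeasureOfNoncompactness μ) {A : ℕ → Set X}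
    (hA : ∀ k, A k ∈ nonemptyBoundedSets X) (hcl : ∀ k, IsClosed (A k))
    (hconv : ∀ k, Convex ℝ (A k)) (hanti : Antitone A)
    (hlim : Tendsto (fun k => μ (A k)) atTop (𝓝 0))
    {T : X → X} (hT : ContinuousOn T (A 0)) (hmaps : ∀ k, Set.MapsTo T (A k) (A (k + 1))) :
    ∃ x ∈ A 0, T x = x := by
  have hne := hμ.iInter_nonempty A hA hcl (fun k => hanti k.le_succ) hlim
  have hbdd : (⋂ k, A k) ∈ nonemptyBoundedSets X :=
    ⟨hne, (hA 0).2.subset (Set.iInter_subset A 0)⟩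
  have hzero : μ (⋂ k, A k) = 0 := le_antisymm
    (ge_of_tendsto' hlim fun k => hμ.mono _ hbdd _ (hA k) (Set.iInter_subset A k)) zero_le
  have hcomp : IsCompact (⋂ k, A k) := by
    simpa [(isClosed_iInter hcl).closure_eq] using hμ.ker_subset _ hbdd hzero
  obtain ⟨x, hx, hfix⟩ := hcomp.exists_fixedPoint_of_convex (convex_iInter hconv) hne
    (hT.mono (Set.iInter_subset A 0)) fun x hx => Set.mem_iInter.2 fun k =>
      hanti k.le_succ (hmaps k (Set.mem_iInter.1 hx k))
  exact ⟨x, Set.mem_iInter.1 hx 0, hfix⟩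

theorem corollary3p5 {X : Type*} [NormedAddCommGroup X] [NormedSpace ℝ X] [CompleteSpace X]
    (E : Set X) (hE_nonempty : E.Nonempty) (hE_bounded : Bornology.IsBounded E)
    (hE_closed : IsClosed E) (hE_convex : Convex ℝ E)
    (T : X → X) (hT_maps : Set.MapsTo T E E) (hT_cont : ContinuousOn T E)
    (μ : Set X → ℝ≥0) (hμ : IsMeasureOfNoncompactness μ)
    (I φ : ℕ → ℝ≥0 → ℝ)
    (hI : TendstoUniformly I (fun u : ℝ≥0 => (u : ℝ)) atTop)
    (hT : ∀ A : Set X, A ⊆ E → A.Nonempty → ∀ n : ℕ, I n (μ (T '' A)) ≤ φ n (μ A))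
    (ha : ∀ u v : ℝ≥0, (∀ n : ℕ, I n u ≤ φ n v) → u ≤ v)
    (hb : ∀ (u v : ℕ → ℝ≥0) (w : ℝ≥0), Tendsto u atTop (𝓝 w) → Tendsto v atTop (𝓝 w) →
      (∀ n k : ℕ, I n (u k) ≤ φ n (v k)) → w = 0) :
    ∃ x ∈ E, T x = x := by
  have hstep (B : Set X) (hBE : B ⊆ E) : closure (convexHull ℝ (T '' B)) ⊆ E :=
    closure_minimal (convexHull_min ((hT_maps.mono_left hBE).image_subset) hE_convex) hE_closed
  have hanti : Antitone (darboSets T E) := antitone_nat_of_succ_le fun k => by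
    induction k with
    | zero => exact hstep E subset_rfl
    | succ k ih => exact closure_mono (convexHull_mono (Set.image_mono ih))
  have hsub (k) : darboSets T E k ⊆ E := hanti k.zero_le
  have hne (k) : (darboSets T E k).Nonempty := by
    induction k with
    | zero => exact hE_nonempty
    | succ k ih => exact (ih.image T).convexHull.closure
  have hmem (k) : darboSets T E k ∈ nonemptyBoundedSets X := ⟨hne k, hE_bounded.subset (hsub k)⟩
  have hclosed (k) : IsClosed (darboSets T E k) := by
    cases k with
    | zero => exact hE_closed
    | succ k => exact isClosed_closure
  have hconv (k) : Convex ℝ (darboSets T E k) := by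
    cases k with
    | zero => exact hE_convex
    | succ k => exact (convex_convexHull ℝ _).closure
  have hmaps (k) : Set.MapsTo T (darboSets T E k) (darboSets T E (k + 1)) := fun x hx =>
    subset_closure (subset_convexHull ℝ _ (Set.mem_image_of_mem T hx))
  have himage (k) : T '' darboSets T E k ∈ nonemptyBoundedSets X :=
    ⟨(hne k).image T, (hmem (k + 1)).2.subset (hmaps k).image_subset⟩
  have hhull (k) : convexHull ℝ (T '' darboSets T E k) ∈ nonemptyBoundedSets X :=
    ⟨(himage k).1.convexHull, (hmem (k + 1)).2.subset subset_closure⟩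
  have hμ_succ (k) : μ (darboSets T E (k + 1)) = μ (T '' darboSets T E k) :=
    (hμ.closure_eq _ (hhull k)).trans (hμ.convexHull_eq _ (himage k))
  have hineq (n k) : I n (μ (darboSets T E (k + 1))) ≤ φ n (μ (darboSets T E k)) :=
    hμ_succ k ▸ hT _ (hsub k) (hne k) n
  have hμ_anti : Antitone fun k => μ (darboSets T E k) :=
    antitone_nat_of_succ_le fun k => ha _ _ fun n => hineq n k
  have hlim := tendsto_atTop_ciInf hμ_anti (OrderBot.bddBelow _)
  -- Both sequences `μ (darboSets T E (k + 1))` and `μ (darboSets T E k)` tend to the infimum,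
  -- so `hb` makes it `0`.
  have hzero := hb _ _ _ ((tendsto_add_atTop_iff_nat 1).2 hlim) hlim hineq
  rw [hzero] at hlim
  exact hμ.exists_fixedPoint hmem hclosed hconv hanti hlim hT_cont hmaps
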